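/- Let $F$ be a finite 4-regular graph (loops and parallel edges allowed; each edge consists of two half-edges, one of which is designated initial when the edge is directed). A circuit is a closed trail with a preferred orientation, taken up to cyclic permutation; a circuit partition of $F$ is a partition of $E(F)$ into circuits; an Euler system is a circuit partition that consists of one Euler circuit in each connected component. A circuit partition respects given edge directions if its circuits traverse every edge in the given direction. A signed version of an Euler system $C$ designates, for each $v\in V(F)$, one of the two passages of $C$ through $v$ as $v^+$, and the other as $v^-$. Let $h_v^1,h_v^2$ be the half-edges along which $C$ enters and leaves $v$ in the passage $v^+$, and $h_v^3,h_v^4$ those for $v^-$. Let $C_1(C,v)$ be the closed trail obtained by following $C$ from $v^-$ to $v^+$ (leaving $v$ along $h_v^4$ and returning along $h_v^1$). For a circuit partition $P$, a single transition of $P$ is a pair $\{a,b\}$ of half-edges at a vertex along which a circuit of $P$ passes through that vertex; for a half-edge $a$, let $\overline a$ be the single transition of $P$ that contains $a$. The touch-graph $Tch(P)$ has the circuits of $P$ as vertices and one edge $e_v$ for each $v\in V(F)$; the two half-edges of $e_v$ are the two single transitions of $P$ at $v$, each incident on the circuit of $P$ that makes it. Direct each $e_v$ so that $\overline{h_v^1}$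 is its initial half-edge. A closed walk $W$ in $F$ induces a closed walk $\overline W$ in $Tch(P)$: whenever $W$ enters $v$ along $a$ and leaves it along $b$, $\overline W$ traverses $e_v$ from $\overline a$ to $\overline b$ if $\overline a\ne\overline b$, and does nothing if $\overline a=\overline b$. The $V(F)\times V(F)$ integer matrix $M^0_{\mathbb R}(C,P)$ has as its $vw$ entry the number of times $\overline{C_1(C,v)}$ traverses $e_w$ in the positive direction minus the number of times it does so in the negative direction. Let $C$ and $C'$ be Euler systems of $F$ that respect the same edge directions. Then for each signed version of $C$ there is a signed version of $C'$ such that: 1. $M^0_{\mathbb R}(C,C')$ is invertible (with an integer inverse) and $M^0_{\mathbb R}(C',C)=M^0_{\mathbb R}(C,C')^{-1}$; 2. for every circuit partition $P$ of $F$ that respects the same edge directions, these signed versions of $C$ and $C'$ satisfy $M^0_{\mathbb R}(C',P)=M^0_{\mathbb R}(C',C)\cdot M^0_{\mathbb R}(C,P)$. -/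

import Mathlib

/-- A 4-regular multigraph (loops and parallel edges allowed), given by its half-edges. Every
half-edge `h` is incident on the vertex `vert h`, and the edges are the pairs `{h, opp h}`. -/
structure FourRegularGraph (V H : Type*) where
  vert : H → V
  opp : H → H
  opp_opp : ∀ h, opp (opp h) = h
  opp_ne : ∀ h, opp h ≠ h
  regular : ∀ v, {h | vert h = v}.ncard = 4

namespace FourRegularGraph

variable {V H : Type*} (F : FourRegularGraph V H)

/-- The edge containing the half-edge `h` joins `vert h` to `vert (opp h)`; two vertices are
connected if a walk leads from the first to the second. -/
def Connected (v w : V) : Prop :=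
  Relation.ReflTransGen (fun x y => ∃ h, F.vert h = x ∧ F.vert (F.opp h) = y) v w

/-- A choice of a direction for each edge: `initial` consists of the initial half-edges. -/
structure EdgeDirections where
  initial : Set H
  one_of : ∀ h, h ∈ initial ↔ F.opp h ∉ initial

/-- A closed walk `v₁, h₁, h₁', v₂, …, v_k, h_k, h_k', v₁`, with `h_i' = opp h_i` and taken up to
cyclic permutation, is represented by the cycle of the half-edges `h₁, …, h_k`. Its passages are
the pairs `(h_i', h_{i+1})`, including `(h_k', h₁)`: the walk enters the vertex `v_{i+1}` along
`h_i'` and leaves it along `h_{i+1}`. -/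
def passages (γ : Cycle H) : Multiset (H × H) :=
  Quotient.liftOn γ
    (fun l => (((l.zip (l.rotate 1)).map fun p => (F.opp p.1, p.2) : List (H × H)) :
      Multiset (H × H)))
    (by
      rintro l _ ⟨n, rfl⟩
      refine Multiset.coe_eq_coe.2 (List.Perm.map _ ?_)
      have h : (l.rotate n).zip ((l.rotate n).rotate 1) = (l.zip (l.rotate 1)).rotate n := by
        simp only [List.zip]
        rw [List.zipWith_rotate_distrib _ _ _ _ (by simp), List.rotate_rotate, List.rotate_rotate,
          Nat.add_comm]
      rw [h]
      exact (List.rotate_perm _ _).symm)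

/-- A circuit: a (nonempty) closed walk that uses no edge twice, in either direction. -/
structure IsCircuit (γ : Cycle H) : Prop where
  ne_nil : γ ≠ Cycle.nil
  walk : ∀ p ∈ F.passages γ, F.vert p.1 = F.vert p.2
  nodup : γ.Nodup
  opp_notMem : ∀ h ∈ γ, F.opp h ∉ γ

/-- `γ` passes, in one direction or the other, through the edge containing `h`. -/
def Traverses (γ : Cycle H) (h : H) : Prop := h ∈ γ ∨ F.opp h ∈ γ

/-- A partition of the edge set into circuits. Circuits carry a preferred orientation. -/
structure CircuitPartition where
  circuits : Set (Cycle H)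
  isCircuit : ∀ γ ∈ circuits, F.IsCircuit γ
  partition : ∀ h, ∃! γ, γ ∈ circuits ∧ F.Traverses γ h

/-- An Euler system: one Euler circuit in each connected component, that is, a circuit partition
in which each circuit uses all the edges of the component in which it lies. -/
structure EulerSystem extends F.CircuitPartition where
  euler : ∀ γ ∈ circuits, ∀ h k, F.Connected (F.vert h) (F.vert k) →
    F.Traverses γ h → F.Traverses γ k

variable {F}

namespace CircuitPartition

variable (P : F.CircuitPartition)

/-- Every circuit of `P` follows the edge directions `d`. -/
def Respects (d : F.EdgeDirections) : Prop := ∀ γ ∈ P.circuits, ∀ h ∈ γ, h ∈ d.initial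

/-- `p` is a passage of a circuit of `P` through the vertex `v`. -/
def IsPassageAt (v : V) (p : H × H) : Prop :=
  (∃ γ ∈ P.circuits, p ∈ F.passages γ) ∧ F.vert p.1 = v

/-- `{a, b}` is one of the single transitions that `P` involves: some circuit of `P` passes through
a vertex along the half-edges `a` and `b`, in one order or the other. -/
def SingleTransition (a b : H) : Prop :=
  ∃ γ ∈ P.circuits, (a, b) ∈ F.passages γ ∨ (b, a) ∈ F.passages γ

/-- The projection `a ↦ ā` from the half-edges of `F` to the half-edges of the touch-graph `Tch(P)`.
The half-edges of `Tch(P)` are the single transitions `{a, b}` of `P`; the edge `e_v` of `Tch(P)`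
consists of the two single transitions of `P` at `v`. -/
def bar (a : H) : Set H := {b | b = a ∨ P.SingleTransition a b}

/-- One step of a walk in `Tch(P)`: the edge `e_v` with `v = edge` is traversed from its half-edge
`source` to its half-edge `target`. -/
structure TouchStep (_P : F.CircuitPartition) where
  edge : V
  source : Set H
  target : Set H

open Classical in
/-- The image in `Tch(P)` of a closed walk in `F`, as the collection of its steps: a passage `(a, b)`
of the walk through `v` traverses `e_v` from `ā` to `b̄`, and is dropped if `ā = b̄`. -/
noncomputable def projectedWalk (γ : Cycle H) : Multiset P.TouchStep :=
  ((F.passages γ).map fun p => ⟨F.vert p.1, P.bar p.1, P.bar p.2⟩).filter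
    fun s => s.source ≠ s.target

open Classical in
/-- The vector `z_D(W)` of a walk in `Tch(P)`, with edges indexed by the vertices of `F`, where the
edge `e_v` is directed by `D` so that its initial half-edge is `D v`: each traversal of `e_v`
contributes `1` to the `v` coordinate if it has the `D` direction, and `-1` if it is opposite. -/
noncomputable def z (D : V → Set H) (W : Multiset P.TouchStep) (v : V) : ℤ :=
  ((W.filter fun s => s.edge = v).map fun s => if s.source = D v then 1 else -1).sum

end CircuitPartition

namespace EulerSystem

/-- A signed version of the Euler system `C`: at each vertex `v`, one of the two passages of `C`
through `v` is designated as `v⁺` and the other as `v⁻`. In the usual notation `plus v = (h¹, h²)`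
and `minus v = (h³, h⁴)`. -/
structure SignedVersion (C : F.EulerSystem) where
  plus : V → H × H
  minus : V → H × H
  plus_passage : ∀ v, C.IsPassageAt v (plus v)
  minus_passage : ∀ v, C.IsPassageAt v (minus v)
  plus_ne_minus : ∀ v, plus v ≠ minus v

namespace SignedVersion

variable {C : F.EulerSystem} (σ : C.SignedVersion)

/-- `γ` is the fundamental circuit `C₁(C, v)` obtained by following a circuit of `C` from `v⁻` to
`v⁺`: it leaves `v` along the half-edge `(minus v).2`, and returns to `v` along `(plus v).1`. -/
def IsFundamental (v : V) (γ : Cycle H) : Prop :=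
  ∃ l₁ l₂ : List H, ((l₁ ++ l₂ : List H) : Cycle H) ∈ C.circuits ∧
    l₁.head? = some (σ.minus v).2 ∧ l₁.getLast? = some (F.opp (σ.plus v).1) ∧
    γ = (l₁ : Cycle H)

theorem mem_of_mem_passages {γ : Cycle H} {p : H × H} (hp : p ∈ F.passages γ) :
    F.opp p.1 ∈ γ ∧ p.2 ∈ γ := by
  induction γ using Quotient.inductionOn with
  | h l =>
    have hp' : p ∈ (l.zip (l.rotate 1)).map fun q => (F.opp q.1, q.2) := hp
    obtain ⟨q, hq, rfl⟩ := List.mem_map.1 hp'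
    obtain ⟨h1, h2⟩ := List.of_mem_zip (a := q.1) (b := q.2) hq
    refine ⟨?_, ?_⟩
    · simpa [F.opp_opp] using h1
    · simpa using h2

theorem exists_isFundamental (v : V) : ∃ γ, σ.IsFundamental v γ := by
  obtain ⟨⟨γ, hγ, hp⟩, hv⟩ := σ.minus_passage v
  obtain ⟨⟨γ', hγ', hp'⟩, hv'⟩ := σ.plus_passage v
  have hm := mem_of_mem_passages hp
  have hm' := mem_of_mem_passages hp'
  have htr : F.Traverses γ (σ.plus v).1 := by
    refine C.euler γ hγ (σ.minus v).1 (σ.plus v).1 ?_ (Or.inr hm.1)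
    rw [hv, hv']
    exact Relation.ReflTransGen.refl
  have heq : γ' = γ :=
    (C.partition (σ.plus v).1).unique ⟨hγ', Or.inr hm'.1⟩ ⟨hγ, htr⟩
  subst heq
  have h4 := hm.2
  have h1 := hm'.1
  clear htr hp hp' hm hm' hγ'
  induction γ' using Quotient.inductionOn with
  | h l =>
    obtain ⟨s, t, rfl⟩ := List.append_of_mem (Cycle.mem_coe_iff.1 h4)
    have hrot : ((s ++ (σ.minus v).2 :: t : List H) : Cycle H) =
        (((σ.minus v).2 :: t ++ s : List H) : Cycle H) :=
      Cycle.coe_eq_coe.2 List.isRotated_append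
    have hγ2 : (((σ.minus v).2 :: t ++ s : List H) : Cycle H) ∈ C.circuits := hrot ▸ hγ
    have h12 : F.opp (σ.plus v).1 ∈ (σ.minus v).2 :: t ++ s := by
      have h13 : F.opp (σ.plus v).1 ∈ s ++ (σ.minus v).2 :: t := Cycle.mem_coe_iff.1 h1
      simp only [List.mem_append] at h13 ⊢
      exact h13.symm
    obtain ⟨a, b, hab⟩ := List.append_of_mem h12
    refine ⟨_, a ++ [F.opp (σ.plus v).1], b, ?_, ?_, ?_, rfl⟩
    · simpa [← hab] using hγ2
    · cases a with
      | nil => simpa using (List.cons.inj hab).1.symm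
      | cons c a => simpa using (List.cons.inj hab).1.symm
    · simp

/-- The fundamental circuit `C₁(C, v)` of the signed version `σ` of `C`. -/
noncomputable def fundamental (v : V) : Cycle H := (σ.exists_isFundamental v).choose

/-- The standard form `M⁰_ℝ(C, P)` for a signed version of `C`. Its `v` row is `z_D` of the image in
`Tch(P)` of `C₁(C, v)`, where `D` directs each edge `e_w` of `Tch(P)` so that the initial half-edge
is the image of the half-edge along which `C` enters `w` in the passage `w⁺`. -/
noncomputable def M0 (P : F.CircuitPartition) : Matrix V V ℤ :=
  Matrix.of fun v w =>
    P.z (fun x => P.bar (σ.plus x).1) (P.projectedWalk (σ.fundamental v)) w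

end SignedVersion

end EulerSystem

end FourRegularGraph

/-! A closed walk that follows the edge directions is recorded by its flow, the number of times it
traverses each half-edge. If a circuit partition `P` respecting the directions enters `w` along
`h_w^1` and leaves along `b`, the `w` coordinate of the walk's image in the touch-graph is the flow
on the edge of `h_w^1` minus the flow on the edge of `b` (`Passage.z_eq`). So `M0` depends linearly
on the flows of the fundamental circuits, and `M0_self` says that `C` against itself gives the
identity.

Choose the signs of `C'` so that both systems share every `h_v^1`. From the flow of `C₁(C', v)`
subtract the combination of the flows of the `C₁(C, u)` with coefficients from row `v` of `M⁰(C',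
C)`. The remainder does not change across any `v⁺` passage of `C`, hence, by conservation at each
vertex, across any `v⁻` passage either. It is therefore constant along each circuit of `C`, and
since that circuit is Eulerian, its image for every `P` is zero: this is the product formula
(`M0_eq_mul`). Taking `P = C'` gives the inverse. -/

namespace FourRegularGraph

variable {V H : Type*} {F : FourRegularGraph V H}

/-! ### Consecutive pairs in a list -/

section ListPairs

variable {α : Type*}

theorem zip_cons_append_singleton (x y : α) (t : List α) :
    (x :: t).zip (t ++ [y]) = (x :: t).zip t ++ [((x :: t).getLast (by simp), y)] := by
  induction t generalizing x with
  | nil => simp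
  | cons z t ih => simpa using ih z

/-- Used to see that the inner passages of an arc of an Euler circuit are passages of the whole
circuit. -/
theorem mem_zip_cons_append {p : α × α} {x z : α} {t s : List α} (h : p ∈ (x :: t).zip t) :
    p ∈ (x :: t ++ s).zip (t ++ s ++ [z]) := by
  induction t generalizing x with
  | nil => simp at h
  | cons y t ih =>
    simp only [List.zip_cons_cons, List.mem_cons, List.cons_append] at h ⊢
    exact h.imp id fun h => by simpa using ih h

theorem forall_eq_of_forall_mem_zip {β : Type*} (g : α → β) {x : α} {t : List α}
    (h : ∀ p ∈ (x :: t).zip t, g p.1 = g p.2) : ∀ y ∈ t, g x = g y := by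
  induction t generalizing x with
  | nil => simp
  | cons z t ih =>
    have hz : g x = g z := h (x, z) (by simp)
    intro y hy
    rcases List.mem_cons.1 hy with rfl | hy
    · exact hz
    · exact hz.trans (ih (fun p hp => h p (by simp [hp])) y hy)

end ListPairs

/-! ### Passages of a closed walk -/

section Passages

theorem passages_coe (l : List H) :
    F.passages (l : Cycle H) = ((l.zip (l.rotate 1)).map fun p => (F.opp p.1, p.2) : List (H × H)) :=
  rfl

theorem map_opp_fst_passages (γ : Cycle H) :
    (F.passages γ).map (fun p => F.opp p.1) = γ.toMultiset := by
  induction γ using Quotient.inductionOn with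
  | h l =>
    change Multiset.map _ (F.passages (l : Cycle H)) = ((l : Cycle H)).toMultiset
    simp only [passages_coe, Multiset.map_coe, List.map_map, Cycle.coe_toMultiset]
    congr 1
    have h : (fun p : H × H => F.opp p.1) ∘ (fun p => (F.opp p.1, p.2)) = Prod.fst := by
      funext p
      simp [F.opp_opp]
    rw [h, List.map_fst_zip (by simp)]

theorem map_snd_passages (γ : Cycle H) : (F.passages γ).map Prod.snd = γ.toMultiset := by
  induction γ using Quotient.inductionOn with
  | h l =>
    change Multiset.map _ (F.passages (l : Cycle H)) = ((l : Cycle H)).toMultiset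
    simp only [passages_coe, Multiset.map_coe, List.map_map, Cycle.coe_toMultiset]
    have h : (Prod.snd : H × H → H) ∘ (fun p => (F.opp p.1, p.2)) = Prod.snd := rfl
    rw [h, List.map_snd_zip (by simp)]
    exact Multiset.coe_eq_coe.2 (List.rotate_perm _ _)

theorem mem_toMultiset {γ : Cycle H} {h : H} : h ∈ γ.toMultiset ↔ h ∈ γ := by
  induction γ using Quotient.inductionOn with
  | h l => exact Iff.rfl

theorem nodup_toMultiset {γ : Cycle H} : γ.toMultiset.Nodup ↔ γ.Nodup := by
  induction γ using Quotient.inductionOn with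
  | h l => exact Iff.rfl

theorem opp_fst_mem {γ : Cycle H} {p : H × H} (hp : p ∈ F.passages γ) : F.opp p.1 ∈ γ :=
  (EulerSystem.SignedVersion.mem_of_mem_passages hp).1

theorem snd_mem {γ : Cycle H} {p : H × H} (hp : p ∈ F.passages γ) : p.2 ∈ γ :=
  (EulerSystem.SignedVersion.mem_of_mem_passages hp).2

theorem exists_passage_fst {γ : Cycle H} {a : H} (ha : F.opp a ∈ γ) :
    ∃ b, (a, b) ∈ F.passages γ := by
  rw [← mem_toMultiset, ← map_opp_fst_passages (F := F), Multiset.mem_map] at ha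
  obtain ⟨⟨a', b⟩, hp, h⟩ := ha
  have : a' = a := by simpa [F.opp_opp] using congrArg F.opp h
  exact ⟨b, this ▸ hp⟩

theorem passage_snd_unique {γ : Cycle H} (hγ : γ.Nodup) {a b b' : H}
    (h : (a, b) ∈ F.passages γ) (h' : (a, b') ∈ F.passages γ) : b = b' := by
  rw [← nodup_toMultiset, ← map_opp_fst_passages (F := F)] at hγ
  exact congrArg Prod.snd (Multiset.inj_on_of_nodup_map hγ _ h _ h' rfl)

theorem passage_fst_unique {γ : Cycle H} (hγ : γ.Nodup) {a a' b : H}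
    (h : (a, b) ∈ F.passages γ) (h' : (a', b) ∈ F.passages γ) : a = a' := by
  rw [← nodup_toMultiset, ← map_snd_passages (F := F)] at hγ
  exact congrArg Prod.fst (Multiset.inj_on_of_nodup_map hγ _ h _ h' rfl)

/-- The passages of the closed walk along a list consist of those joining consecutive members, and
of the one that closes the walk. -/
theorem passages_coe_cons (x : H) (t : List H) :
    F.passages ((x :: t : List H) : Cycle H) =
      (F.opp ((x :: t).getLast (by simp)), x) ::ₘ
        (((x :: t).zip t).map fun p => (F.opp p.1, p.2) : List (H × H)) := by
  rw [passages_coe, List.rotate_cons_succ, List.rotate_zero, zip_cons_append_singleton,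
    List.map_append, ← Multiset.coe_add, add_comm]
  rfl

/-- A function on half-edges that agrees at consecutive members of a closed walk is constant. -/
theorem eq_of_forall_passages {β : Type*} (g : H → β) {γ : Cycle H}
    (h : ∀ p ∈ F.passages γ, g (F.opp p.1) = g p.2) {x y : H} (hx : x ∈ γ) (hy : y ∈ γ) :
    g x = g y := by
  induction γ using Quotient.inductionOn with
  | h l =>
    cases l with
    | nil => exact absurd hx (Cycle.notMem_nil x)
    | cons z t =>
      change ∀ p ∈ F.passages ((z :: t : List H) : Cycle H), _ at h
      rw [passages_coe_cons] at h
      have hz : ∀ u ∈ t, g z = g u := forall_eq_of_forall_mem_zip g fun p hp => by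
        have h1 := h (F.opp p.1, p.2)
          (Multiset.mem_cons_of_mem (Multiset.mem_coe.2 (List.mem_map.2 ⟨p, hp, rfl⟩)))
        simpa [F.opp_opp] using h1
      have hz' : ∀ u ∈ z :: t, g z = g u := by simpa using hz
      exact (hz' x hx).symm.trans (hz' y hy)

end Passages

/-! ### Transitions of a partition that respects edge directions -/

namespace CircuitPartition

variable (P : F.CircuitPartition)

/-- `(a, b)` is a passage of a circuit of `P`. -/
def Passage (a b : H) : Prop := ∃ γ ∈ P.circuits, (a, b) ∈ F.passages γ

variable {P} {d : F.EdgeDirections}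

theorem Passage.vert_eq {a b : H} (h : P.Passage a b) : F.vert a = F.vert b := by
  obtain ⟨γ, hγ, hp⟩ := h
  exact (P.isCircuit γ hγ).walk _ hp

theorem Passage.notMem_initial (hP : P.Respects d) {a b : H} (h : P.Passage a b) :
    a ∉ d.initial := by
  obtain ⟨γ, hγ, hp⟩ := h
  have h1 := hP γ hγ _ (opp_fst_mem hp)
  rwa [d.one_of, F.opp_opp] at h1

theorem Passage.mem_initial (hP : P.Respects d) {a b : H} (h : P.Passage a b) :
    b ∈ d.initial := by
  obtain ⟨γ, hγ, hp⟩ := h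
  exact hP γ hγ _ (snd_mem hp)

theorem eq_of_mem {γ γ' : Cycle H} (hγ : γ ∈ P.circuits) (hγ' : γ' ∈ P.circuits) {h : H}
    (hh : h ∈ γ) (hh' : h ∈ γ') : γ = γ' :=
  (P.partition h).unique ⟨hγ, Or.inl hh⟩ ⟨hγ', Or.inl hh'⟩

theorem Passage.snd_unique {a b b' : H} (h : P.Passage a b) (h' : P.Passage a b') : b = b' := by
  obtain ⟨γ, hγ, hp⟩ := h
  obtain ⟨γ', hγ', hp'⟩ := h'
  obtain rfl := eq_of_mem hγ hγ' (opp_fst_mem hp) (opp_fst_mem (p := (a, b')) hp')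
  exact passage_snd_unique (P.isCircuit γ hγ).nodup hp hp'

theorem Passage.fst_unique {a a' b : H} (h : P.Passage a b) (h' : P.Passage a' b) : a = a' := by
  obtain ⟨γ, hγ, hp⟩ := h
  obtain ⟨γ', hγ', hp'⟩ := h'
  obtain rfl := eq_of_mem hγ hγ' (snd_mem hp) (snd_mem (p := (a', b)) hp')
  exact passage_fst_unique (P.isCircuit γ hγ).nodup hp hp'

theorem exists_passage (hP : P.Respects d) {a : H} (ha : a ∉ d.initial) : ∃ b, P.Passage a b := by
  obtain ⟨γ, ⟨hγ, hat | hat⟩, -⟩ := P.partition a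
  · exact absurd (hP γ hγ _ hat) ha
  · obtain ⟨b, hb⟩ := exists_passage_fst hat
    exact ⟨b, γ, hγ, hb⟩

theorem singleTransition_iff {a b : H} : P.SingleTransition a b ↔ P.Passage a b ∨ P.Passage b a := by
  simp only [SingleTransition, Passage, ← exists_or, ← and_or_left]

/-- Directions separate entering from leaving half-edges, so a non-initial half-edge can only be the
first entry of a passage, and that passage is unique. -/
theorem Passage.bar_fst (hP : P.Respects d) {a b : H} (h : P.Passage a b) : P.bar a = {a, b} := by
  ext c
  simp only [bar, singleTransition_iff, Set.mem_ofPred_eq, Set.mem_insert_iff,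
    Set.mem_singleton_iff]
  constructor
  · rintro (rfl | h' | h')
    · exact Or.inl rfl
    · exact Or.inr (h'.snd_unique h)
    · exact absurd (h'.mem_initial hP) (h.notMem_initial hP)
  · rintro (rfl | rfl)
    · exact Or.inl rfl
    · exact Or.inr (Or.inl h)

theorem Passage.bar_snd (hP : P.Respects d) {a b : H} (h : P.Passage a b) : P.bar b = {a, b} := by
  ext c
  simp only [bar, singleTransition_iff, Set.mem_ofPred_eq, Set.mem_insert_iff,
    Set.mem_singleton_iff]
  constructor
  · rintro (rfl | h' | h')
    · exact Or.inr rfl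
    · exact absurd (h.mem_initial hP) (h'.notMem_initial hP)
    · exact Or.inl (h'.fst_unique h)
  · rintro (rfl | rfl)
    · exact Or.inr (Or.inr h)
    · exact Or.inl rfl

theorem self_mem_bar (a : H) : a ∈ P.bar a := Or.inl rfl

theorem Passage.bar_eq_bar_snd_iff (hP : P.Respects d) {a b c : H} (h : P.Passage a b)
    (hc : c ∈ d.initial) : P.bar a = P.bar c ↔ c = b := by
  constructor
  · intro he
    have h1 : c ∈ P.bar a := he ▸ self_mem_bar c
    rw [h.bar_fst hP] at h1
    rcases h1 with rfl | h1
    · exact absurd hc (h.notMem_initial hP)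
    · exact h1
  · rintro rfl
    rw [h.bar_fst hP, h.bar_snd hP]

theorem Passage.bar_eq_bar_fst_iff (hP : P.Respects d) {a b c : H} (h : P.Passage a b)
    (hc : c ∉ d.initial) : P.bar c = P.bar a ↔ c = a := by
  constructor
  · intro he
    have h1 : c ∈ P.bar a := he ▸ self_mem_bar c
    rw [h.bar_fst hP] at h1
    rcases h1 with rfl | h1
    · rfl
    · obtain rfl : c = b := h1
      exact absurd (h.mem_initial hP) hc
  · rintro rfl
    rfl

/-- Two passages of `P` through a vertex involve all the half-edges at that vertex. -/
theorem Passage.eq_of_vert_eq (hP : P.Respects d) {a a' b b' : H} (h : P.Passage a b)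
    (h' : P.Passage a' b') (hne : a ≠ a') (hv : F.vert a = F.vert a') {c : H}
    (hc : F.vert c = F.vert a) : c = a ∨ c = a' ∨ c = b ∨ c = b' := by
  classical
  have hbb : b ≠ b' := by
    rintro rfl
    exact hne (h.fst_unique h')
  have hne2 : ∀ {x y x' y'}, P.Passage x y → P.Passage x' y' → x ≠ y' := by
    rintro x y x' y' h1 h2 rfl
    exact h1.notMem_initial hP (h2.mem_initial hP)
  have hcard : ({a, a', b, b'} : Finset H).card = 4 := by
    rw [Finset.card_insert_of_notMem, Finset.card_insert_of_notMem, Finset.card_pair hbb]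
    · simp [hne2 h' h, hne2 h' h']
    · simp [hne, hne2 h h, hne2 h h']
  have hreg := F.regular (F.vert a)
  have hsub : (({a, a', b, b'} : Finset H) : Set H) ⊆ {x | F.vert x = F.vert a} := by
    intro x hx
    simp only [Finset.coe_insert, Finset.coe_singleton, Set.mem_insert_iff,
      Set.mem_singleton_iff] at hx
    rcases hx with rfl | rfl | rfl | rfl
    · rfl
    · exact hv.symm
    · exact h.vert_eq.symm
    · exact h'.vert_eq.symm.trans hv.symm
  have heq := Set.eq_of_subset_of_ncard_le hsub
    (by rw [hreg, Set.ncard_coe_finset, hcard])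
    -- `ncard` is 0 on infinite sets, so the value 4 forces finiteness.
    (Set.finite_of_ncard_ne_zero (by rw [hreg]; norm_num))
  have hmem : c ∈ (({a, a', b, b'} : Finset H) : Set H) := by
    rw [heq]
    exact hc
  simpa using hmem

theorem Passage.fst_of_vert_eq (hP : P.Respects d) {a a' b b' : H} (h : P.Passage a b)
    (h' : P.Passage a' b') (hne : a ≠ a') (hv : F.vert a = F.vert a') {c : H}
    (hc : F.vert c = F.vert a) (hi : c ∉ d.initial) : c = a ∨ c = a' := by
  rcases h.eq_of_vert_eq hP h' hne hv hc with h1 | h1 | rfl | rfl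
  · exact Or.inl h1
  · exact Or.inr h1
  · exact absurd (h.mem_initial hP) hi
  · exact absurd (h'.mem_initial hP) hi

theorem Passage.snd_of_vert_eq (hP : P.Respects d) {a a' b b' : H} (h : P.Passage a b)
    (h' : P.Passage a' b') (hne : a ≠ a') (hv : F.vert a = F.vert a') {c : H}
    (hc : F.vert c = F.vert a) (hi : c ∈ d.initial) : c = b ∨ c = b' := by
  rcases h.eq_of_vert_eq hP h' hne hv hc with rfl | rfl | h1 | h1
  · exact absurd hi (h.notMem_initial hP)
  · exact absurd hi (h'.notMem_initial hP)
  · exact Or.inl h1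
  · exact Or.inr h1

end CircuitPartition

/-! ### Directed walks and their flows -/

/-- A closed walk that follows the edge directions `d`. -/
structure IsDirectedWalk (d : F.EdgeDirections) (γ : Cycle H) : Prop where
  walk : ∀ p ∈ F.passages γ, F.vert p.1 = F.vert p.2
  directed : ∀ h ∈ γ, h ∈ d.initial

theorem IsDirectedWalk.fst_notMem {d : F.EdgeDirections} {γ : Cycle H} (hγ : IsDirectedWalk d γ)
    {p : H × H} (hp : p ∈ F.passages γ) : p.1 ∉ d.initial := by
  have h1 := hγ.directed _ (opp_fst_mem hp)
  rwa [d.one_of, F.opp_opp] at h1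

open Classical in
/-- The number of times that a closed walk traverses each half-edge. -/
noncomputable def flow (γ : Cycle H) (h : H) : ℤ := γ.toMultiset.count h

open Classical in
theorem sum_map_ite_eq {α β : Type*} (s : Multiset α) (f : α → β) (b : β) :
    (s.map fun x => if f x = b then (1 : ℤ) else 0).sum = (s.map f).count b := by
  induction s using Multiset.induction_on with
  | empty => simp
  | cons x s ih =>
    simp only [Multiset.map_cons, Multiset.sum_cons, ih, Multiset.count_cons, eq_comm (a := b)]
    split_ifs <;> push_cast <;> ring

open Classical in
theorem flow_opp_eq_sum (γ : Cycle H) (a : H) :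
    flow γ (F.opp a) = ((F.passages γ).map fun p => if p.1 = a then (1 : ℤ) else 0).sum := by
  rw [flow, ← map_opp_fst_passages (F := F), ← sum_map_ite_eq]
  have hinj : Function.Injective F.opp := fun x y h => by
    simpa [F.opp_opp] using congrArg F.opp h
  simp only [hinj.eq_iff]

open Classical in
theorem flow_eq_sum (γ : Cycle H) (b : H) :
    flow γ b = ((F.passages γ).map fun p => if p.2 = b then (1 : ℤ) else 0).sum := by
  rw [flow, ← map_snd_passages (F := F), ← sum_map_ite_eq]

namespace CircuitPartition

variable {P : F.CircuitPartition} {d : F.EdgeDirections} {γ : Cycle H}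

/-- What enters a vertex leaves it. -/
theorem Passage.flow_add (hP : P.Respects d) (hγ : IsDirectedWalk d γ) {a a' b b' : H}
    (h : P.Passage a b) (h' : P.Passage a' b') (hne : a ≠ a') (hv : F.vert a = F.vert a') :
    flow γ (F.opp a) + flow γ (F.opp a') = flow γ b + flow γ b' := by
  classical
  have hbb : b ≠ b' := by
    rintro rfl
    exact hne (h.fst_unique h')
  rw [flow_opp_eq_sum, flow_opp_eq_sum, flow_eq_sum (F := F), flow_eq_sum (F := F),
    ← Multiset.sum_map_add, ← Multiset.sum_map_add]
  refine congrArg Multiset.sum (Multiset.map_congr rfl fun p hp => ?_)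
  have hw := hγ.walk p hp
  by_cases hpv : F.vert p.1 = F.vert a
  · have h1 := h.fst_of_vert_eq hP h' hne hv hpv (hγ.fst_notMem hp)
    have h2 := h.snd_of_vert_eq hP h' hne hv (hw.symm.trans hpv) (hγ.directed _ (snd_mem hp))
    rcases h1 with h1 | h1 <;> rcases h2 with h2 | h2 <;>
      simp [h1, h2, hne, hne.symm, hbb, hbb.symm]
  · have h1 : p.1 ≠ a := fun h1 => hpv (h1 ▸ rfl)
    have h2 : p.1 ≠ a' := fun h1 => hpv (h1 ▸ hv.symm)
    have h3 : p.2 ≠ b := fun h1 => hpv (hw.trans (h1 ▸ h.vert_eq.symm))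
    have h4 : p.2 ≠ b' := fun h1 => hpv (hw.trans (h1 ▸ h'.vert_eq.symm.trans hv.symm))
    simp [h1, h2, h3, h4]

open Classical in
theorem z_projectedWalk (D : V → Set H) (γ : Cycle H) (w : V) :
    P.z D (P.projectedWalk γ) w = ((F.passages γ).map fun p =>
      if F.vert p.1 = w then if P.bar p.1 = P.bar p.2 then (0 : ℤ) else
        if P.bar p.1 = D w then 1 else -1 else 0).sum := by
  unfold z projectedWalk
  induction F.passages γ using Multiset.induction_on with
  | empty => simp
  | cons p s ih =>
    rw [Multiset.map_cons, Multiset.map_cons, Multiset.sum_cons, ← ih]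
    by_cases h1 : P.bar p.1 = P.bar p.2 <;> by_cases h2 : F.vert p.1 = w <;> simp [h1, h2]

/-- The vector of the image of a directed walk in the touch-graph is a linear function of the
flow of that walk. -/
theorem Passage.z_eq (hP : P.Respects d) (hγ : IsDirectedWalk d γ) {D : V → Set H} {w : V}
    {a b : H} (h : P.Passage a b) (hw : F.vert a = w) (hD : D w = P.bar a) :
    P.z D (P.projectedWalk γ) w = flow γ (F.opp a) - flow γ b := by
  classical
  rw [z_projectedWalk, flow_opp_eq_sum, flow_eq_sum (F := F), ← Multiset.sum_map_sub]
  refine congrArg Multiset.sum (Multiset.map_congr rfl fun p hp => ?_)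
  have hpw := hγ.walk p hp
  have hp1 := hγ.fst_notMem hp
  have hp2 := hγ.directed _ (snd_mem hp)
  by_cases hpv : F.vert p.1 = w
  -- Entering along `a` contributes 1 unless the walk leaves along `b`. Entering along the other
  -- entrance, whose exit in `P` is `c ≠ b`, contributes 0 if the walk leaves along `c` and -1 if it
  -- leaves along `b`.
  · obtain ⟨c, hc⟩ := exists_passage hP hp1
    simp only [hpv, if_true, hD, hc.bar_eq_bar_snd_iff hP hp2, h.bar_eq_bar_fst_iff hP hp1]
    by_cases hpa : p.1 = a
    · obtain rfl : c = b := (hpa ▸ hc).snd_unique h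
      by_cases h2 : p.2 = c <;> simp [hpa, h2]
    · have hcb : c ≠ b := by
        rintro rfl
        exact hpa (hc.fst_unique h)
      rcases hc.snd_of_vert_eq hP h hpa (hpv.trans hw.symm) hpw.symm hp2 with h2 | h2
      · simp [hpa, h2, hcb]
      · simp [hpa, h2, hcb.symm]
  · have h1 : p.1 ≠ a := fun h1 => hpv (h1 ▸ hw)
    have h2 : p.2 ≠ b := fun h1 => hpv (hpw.trans (h1 ▸ h.vert_eq.symm.trans hw))
    simp [hpv, h1, h2]

end CircuitPartition

/-! ### Fundamental circuits and the matrices `M0` -/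

namespace EulerSystem

namespace SignedVersion

open CircuitPartition

variable {C : F.EulerSystem} (σ : C.SignedVersion) {d : F.EdgeDirections}

theorem passage_plus (v : V) : C.Passage (σ.plus v).1 (σ.plus v).2 := (σ.plus_passage v).1

theorem passage_minus (v : V) : C.Passage (σ.minus v).1 (σ.minus v).2 := (σ.minus_passage v).1

theorem vert_plus (v : V) : F.vert (σ.plus v).1 = v := (σ.plus_passage v).2

theorem vert_minus (v : V) : F.vert (σ.minus v).1 = v := (σ.minus_passage v).2

theorem plus_fst_ne (v : V) : (σ.plus v).1 ≠ (σ.minus v).1 := fun h =>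
  σ.plus_ne_minus v (Prod.ext h ((h ▸ σ.passage_plus v).snd_unique (σ.passage_minus v)))

theorem plus_snd_ne (v : V) : (σ.plus v).2 ≠ (σ.minus v).2 := fun h =>
  σ.plus_fst_ne v ((h ▸ σ.passage_plus v).fst_unique (σ.passage_minus v))

/-- The fundamental circuit at `v` consists of passages of the Euler system and of one passage that
enters `v` as `v⁺` does, and leaves as `v⁻` does. -/
theorem exists_passages_fundamental (v : V) :
    ∃ s : Multiset (H × H),
      F.passages (σ.fundamental v) = ((σ.plus v).1, (σ.minus v).2) ::ₘ s ∧
        ∀ p ∈ s, C.Passage p.1 p.2 := by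
  obtain ⟨l, m, hlm, hhead, hlast, hf⟩ := (σ.exists_isFundamental v).choose_spec
  change σ.fundamental v = _ at hf
  cases l with
  | nil => simp at hhead
  | cons x t =>
    obtain rfl : x = (σ.minus v).2 := by simpa using hhead
    have hl : ((σ.minus v).2 :: t).getLast (by simp) = F.opp (σ.plus v).1 := by
      rw [List.getLast?_eq_some_getLast (by simp)] at hlast
      exact Option.some.inj hlast
    refine ⟨_, by rw [hf, passages_coe_cons, hl, F.opp_opp], fun p hp => ⟨_, hlm, ?_⟩⟩
    obtain ⟨q, hq, rfl⟩ := List.mem_map.1 (Multiset.mem_coe.1 hp)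
    rw [passages_coe]
    refine Multiset.mem_coe.2 (List.mem_map.2 ⟨q, ?_, rfl⟩)
    rw [List.cons_append, List.rotate_cons_succ, List.rotate_zero]
    exact mem_zip_cons_append hq

theorem isDirectedWalk_fundamental (hC : C.Respects d) (v : V) :
    IsDirectedWalk d (σ.fundamental v) := by
  obtain ⟨s, hs, hC'⟩ := σ.exists_passages_fundamental v
  have key : ∀ p ∈ F.passages (σ.fundamental v), F.vert p.1 = F.vert p.2 ∧ p.2 ∈ d.initial := by
    intro p hp
    rw [hs, Multiset.mem_cons] at hp
    rcases hp with rfl | hp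
    · exact ⟨(σ.vert_plus v).trans ((σ.vert_minus v).symm.trans (σ.passage_minus v).vert_eq),
        (σ.passage_minus v).mem_initial hC⟩
    · exact ⟨(hC' p hp).vert_eq, (hC' p hp).mem_initial hC⟩
  refine ⟨fun p hp => (key p hp).1, fun h hh => ?_⟩
  rw [← mem_toMultiset, ← map_snd_passages (F := F), Multiset.mem_map] at hh
  obtain ⟨p, hp, rfl⟩ := hh
  exact (key p hp).2

theorem M0_apply (hC : C.Respects d) {P : F.CircuitPartition} (hP : P.Respects d) (v w : V) {b : H}
    (hb : P.Passage (σ.plus w).1 b) :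
    σ.M0 P v w = flow (σ.fundamental v) (F.opp (σ.plus w).1) - flow (σ.fundamental v) b :=
  hb.z_eq hP (σ.isDirectedWalk_fundamental hC v) (D := fun x => P.bar (σ.plus x).1)
    (σ.vert_plus w) rfl

/-- Passages of `C` project to nothing in its own touch-graph; only the passage of `C₁(C, v)` from
`h_v^1` to `h_v^4` switches transitions, and it crosses `e_v` once, positively. -/
theorem M0_self [DecidableEq V] (hC : C.Respects d) : σ.M0 C.toCircuitPartition = 1 := by
  classical
  ext v w
  rw [σ.M0_apply hC hC v w (σ.passage_plus w), flow_opp_eq_sum, flow_eq_sum (F := F),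
    ← Multiset.sum_map_sub]
  obtain ⟨s, hs, hC'⟩ := σ.exists_passages_fundamental v
  have hzero : ∀ p ∈ s, ((if p.1 = (σ.plus w).1 then (1 : ℤ) else 0) -
      if p.2 = (σ.plus w).2 then 1 else 0) = 0 := by
    intro p hp
    have hiff : p.1 = (σ.plus w).1 ↔ p.2 = (σ.plus w).2 :=
      ⟨fun h => (h ▸ hC' p hp).snd_unique (σ.passage_plus w),
        fun h => (h ▸ hC' p hp).fst_unique (σ.passage_plus w)⟩
    simp [hiff]
  rw [hs, Multiset.map_cons, Multiset.sum_cons, Multiset.map_congr rfl hzero]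
  by_cases hvw : v = w
  · subst hvw
    simp [(σ.plus_snd_ne v).symm]
  · have h1 : (σ.plus v).1 ≠ (σ.plus w).1 := fun h =>
      hvw (by rw [← σ.vert_plus v, h, σ.vert_plus w])
    have h2 : (σ.minus v).2 ≠ (σ.plus w).2 := fun h => hvw (by
      rw [← σ.vert_minus v, (σ.passage_minus v).vert_eq, h, ← (σ.passage_plus w).vert_eq,
        σ.vert_plus w])
    simp [h1, h2, hvw]

/-- A second Euler system respecting the same directions has a signed version in which the
designated passages enter each vertex along the same half-edges. -/
theorem exists_plus_fst_eq (hC : C.Respects d) {C' : F.EulerSystem} (hC' : C'.Respects d) :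
    ∃ σ' : C'.SignedVersion, ∀ v, (σ'.plus v).1 = (σ.plus v).1 := by
  choose b hb using fun v => exists_passage hC' ((σ.passage_plus v).notMem_initial hC)
  choose c hc using fun v => exists_passage hC' ((σ.passage_minus v).notMem_initial hC)
  exact ⟨{  plus := fun v => ((σ.plus v).1, b v)
            minus := fun v => ((σ.minus v).1, c v)
            plus_passage := fun v => ⟨hb v, σ.vert_plus v⟩
            minus_passage := fun v => ⟨hc v, σ.vert_minus v⟩
            plus_ne_minus := fun v h => σ.plus_fst_ne v (Prod.mk.inj h).1 }, fun _ => rfl⟩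

/-- The coefficients are forced by the case `P = C`; that they work for every `P` comes from the
constancy of the remainder `g` along Euler circuits. -/
theorem M0_eq_mul [Fintype V] [DecidableEq V] {C' : F.EulerSystem} (hC : C.Respects d)
    (hC' : C'.Respects d) (σ' : C'.SignedVersion) (hσ : ∀ v, (σ'.plus v).1 = (σ.plus v).1)
    {P : F.CircuitPartition} (hP : P.Respects d) :
    σ'.M0 P = σ'.M0 C.toCircuitPartition * σ.M0 P := by
  ext v w
  let g : H → ℤ := fun h => flow (σ'.fundamental v) h -
    ∑ u, σ'.M0 C.toCircuitPartition v u * flow (σ.fundamental u) h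
  have hg : ∀ {Q : F.CircuitPartition}, Q.Respects d → ∀ x b, Q.Passage (σ.plus x).1 b →
      g (F.opp (σ.plus x).1) - g b =
        σ'.M0 Q v x - (σ'.M0 C.toCircuitPartition * σ.M0 Q) v x := by
    intro Q hQ x b hb
    -- The shared entrance `h_x^1` is essential: both matrices are then read off from the same pair
    -- of half-edges.
    rw [σ'.M0_apply hC' hQ v x ((hσ x).symm ▸ hb), hσ, Matrix.mul_apply]
    simp only [σ.M0_apply hC hQ _ x hb, mul_sub, Finset.sum_sub_distrib, g]
    ring
  have hplus : ∀ x, g (F.opp (σ.plus x).1) = g (σ.plus x).2 := by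
    intro x
    have h1 := hg hC x _ (σ.passage_plus x)
    rw [σ.M0_self hC, mul_one, sub_self] at h1
    exact sub_eq_zero.1 h1
  have hadd : ∀ x, g (F.opp (σ.plus x).1) + g (F.opp (σ.minus x).1) =
      g (σ.plus x).2 + g (σ.minus x).2 := by
    intro x
    have hflow : ∀ {γ : Cycle H}, IsDirectedWalk d γ → _ := fun hγ =>
      (σ.passage_plus x).flow_add hC hγ (σ.passage_minus x) (σ.plus_fst_ne x)
        ((σ.vert_plus x).trans (σ.vert_minus x).symm)
    have h2 : ∑ u, σ'.M0 C.toCircuitPartition v u * flow (σ.fundamental u) (F.opp (σ.plus x).1) +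
        ∑ u, σ'.M0 C.toCircuitPartition v u * flow (σ.fundamental u) (F.opp (σ.minus x).1) =
        ∑ u, σ'.M0 C.toCircuitPartition v u * flow (σ.fundamental u) (σ.plus x).2 +
        ∑ u, σ'.M0 C.toCircuitPartition v u * flow (σ.fundamental u) (σ.minus x).2 := by
      simp only [← Finset.sum_add_distrib, ← mul_add,
        hflow (σ.isDirectedWalk_fundamental hC _)]
    have h1 := hflow (σ'.isDirectedWalk_fundamental hC' v)
    simp only [g]
    linarith
  have hpass : ∀ γ ∈ C.circuits, ∀ p ∈ F.passages γ, g (F.opp p.1) = g p.2 := by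
    rintro γ hγ ⟨a, b⟩ hp
    have hab : C.Passage a b := ⟨γ, hγ, hp⟩
    have hx := hplus (F.vert a)
    rcases (σ.passage_plus (F.vert a)).fst_of_vert_eq hC (σ.passage_minus (F.vert a))
      (σ.plus_fst_ne _) ((σ.vert_plus _).trans (σ.vert_minus _).symm) (c := a)
      (σ.vert_plus _).symm (hab.notMem_initial hC) with h | h
    · have hb : b = (σ.plus (F.vert a)).2 :=
        hab.snd_unique (h.symm ▸ σ.passage_plus (F.vert a) :)
      rw [← h, ← hb] at hx
      exact hx
    · have hb : b = (σ.minus (F.vert a)).2 :=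
        hab.snd_unique (h.symm ▸ σ.passage_minus (F.vert a) :)
      have h2 := hadd (F.vert a)
      rw [← h, ← hb, hx] at h2
      exact add_left_cancel h2
  obtain ⟨b, hb⟩ := exists_passage hP ((σ.passage_plus w).notMem_initial hC)
  obtain ⟨γ, hγ, hp⟩ := σ.passage_plus w
  -- The Euler circuit through `w⁺` uses every edge at `w`, and the directions exclude its
  -- traversing that of `b` backwards.
  have hbγ : b ∈ γ := by
    have hconn : F.Connected (F.vert (σ.plus w).1) (F.vert b) := by
      rw [hb.vert_eq]
      exact Relation.ReflTransGen.refl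
    rcases C.euler γ hγ _ _ hconn (Or.inr (opp_fst_mem hp)) with h | h
    · exact h
    · exact absurd (hC γ hγ _ h) ((d.one_of b).1 (hb.mem_initial hP))
  have h1 := hg hP w b hb
  rw [eq_of_forall_passages g (hpass γ hγ) (opp_fst_mem hp) hbγ, sub_self] at h1
  exact (sub_eq_zero.1 h1.symm)

end SignedVersion

end EulerSystem

end FourRegularGraph

theorem mainTheorem5 {V H : Type*} [Fintype V] [DecidableEq V] (F : FourRegularGraph V H)
    (d : F.EdgeDirections) (C C' : F.EulerSystem)
    (hC : C.Respects d) (hC' : C'.Respects d) (σ : C.SignedVersion) :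
    ∃ σ' : C'.SignedVersion,
      IsUnit (σ.M0 C'.toCircuitPartition) ∧
      σ'.M0 C.toCircuitPartition = (σ.M0 C'.toCircuitPartition)⁻¹ ∧
      ∀ P : F.CircuitPartition, P.Respects d →
        σ'.M0 P = σ'.M0 C.toCircuitPartition * σ.M0 P := by
  obtain ⟨σ', hσ'⟩ := σ.exists_plus_fst_eq hC hC'
  have hmul := fun {P : F.CircuitPartition} (hP : P.Respects d) => σ.M0_eq_mul hC hC' σ' hσ' hP
  have hone : σ'.M0 C.toCircuitPartition * σ.M0 C'.toCircuitPartition = 1 := by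
    rw [← hmul hC', σ'.M0_self hC']
  -- A one-sided inverse suffices for finite square matrices over a commutative ring.
  exact ⟨σ', IsUnit.of_mul_eq_one_right _ hone, (Matrix.inv_eq_left_inv hone).symm,
    fun P hP => hmul hP⟩
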